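/- Let $(\Omega,\mathscr F,\mathbb P,\theta)$ be a stationary ergodic quadruple: $(\Omega,\mathscr F,\mathbb P)$ is a probability space and $\theta:\Omega\to\Omega$ is a bimeasurable bijection that preserves $\mathbb P$ and is ergodic. Let $\sigma\ge 0$ and $\tau>0$ (a.s.) be integrable real random variables ($\sigma$ is the service time of the customer arriving at time $0$, $\tau$ the time until the next arrival). Let $1\le p\le S-1$ be integers. For $q\ge 1$ let $\overline{(\mathbb R_+)^q}$ be the set of vectors $u=(u(1),\dots,u(q))$ with $0\le u(1)\le\dots\le u(q)$, ordered coordinatewise; for $u\in\mathbb R^q$ let $\overline u$ be its nondecreasing rearrangement; $x^+=x\vee 0$, also coordinatewise; $\mathbf e_i$ is the $i$-th unit vector and $\mathbf 1=(1,\dots,1)$. Define random maps as follows. For $u\in\overline{(\mathbb R_+)^p}$, $\Psi^p(u)(j)=\big[(u(j)\vee\sigma)\wedge u(j+1)-\tau\big]^+$ for $1\le j\le p-1$, and $\Psi^p(u)(p)=\big[u(p)\vee\sigma-\tau\big]^+$. For $u\in\overline{(\mathbb R_+)^S}$, put $x_j=\sigma$ for $j\le p$ and $x_j=\sigma+u(p+1)\mathbf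 1_{\{u(1)>0\}}$ for $j\ge p+1$; then $\Phi^p(u)(j)=\big[(u(j)\vee x_j)\wedge u(j+1)-\tau\big]^+$ for $1\le j\le S-1$, and $\Phi^p(u)(S)=\big[u(S)\vee x_S-\tau\big]^+$. For $u\in\overline{(\mathbb R_+)^S}$, $G^p(u)=\overline{[u+\sigma\mathbf e_1-\tau\mathbf 1]^+}$ if $u(1)=0$ and $G^p(u)=\overline{[u+\sigma\mathbf e_{p+1}-\tau\mathbf 1]^+}$ if $u(1)>0$ (the service profile recursion of $S$ parallel servers under "join the $(p+1)$-th shortest workload", J$_{p+1}$SW). A proper solution of $X\circ\theta=F(X)$ is a random vector $X$ on $\Omega$ with values in $\overline{(\mathbb R_+)^q}$ (in particular finite) that satisfies the equation a.s.; it is minimal if it is a.s. coordinatewise below every proper solution. **Proposition.** Suppose that every proper solution $Y$ of $Y\circ\theta=\Psi^p(Y)$ satisfies $\mathbb E[\sigma\mathbf 1_{\{Y(1)>0\}}]<(S-p)\,\mathbb E[\tau]$. Then the equation $V\circ\theta=\Phi^p(V)$ has a minimal proper solution $V^p$ (clearly a.s. unique), and if moreover $$\mathbb P\Big(\{V^p(1)=0\}\cap\bigcap_{\ell=2}^{S}\Big\{V^p(\ell)\le\sum_{i=0}^{\ell-2}\tau\circ\theta^i\Big\}\Big)>0,$$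 then the J$_{p+1}$SW equation $W\circ\theta=G^p(W)$ a.s. has at least one proper solution $W^p$. -/

import Mathlib

open MeasureTheory Filter

namespace JSW

noncomputable section

/-- `u` belongs to the set of fully ordered vectors with nonnegative coordinates
(coordinates are numbered from `0`). -/
def IsOrderedProfile {q : ℕ} (u : Fin q → ℝ) : Prop :=
  Monotone u ∧ ∀ i, 0 ≤ u i

/-- The fully ordered (nondecreasing) version of a vector. -/
def ascending {q : ℕ} (u : Fin q → ℝ) : Fin q → ℝ :=
  u ∘ Tuple.sort u

/-- Workloads just before the next arrival, ranked in ascending order, if the current customer, of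
service time `s`, joins the server with the `k`-th workload (numbered from `0`) and the next
customer arrives after a time `t`. -/
def routeTo {q : ℕ} (k : Fin q) (s t : ℝ) (u : Fin q → ℝ) : Fin q → ℝ :=
  ascending (fun i => max (u i + (if i = k then s else 0) - t) 0)

/-- The map `G^p` driving the service profile of `S` servers under "join the `(p+1)`-th shortest
workload": the customer goes to a free server if there is one, and otherwise to the server with the
`(p+1)`-th smallest workload. -/
def GMap {S p : ℕ} (hpS : p < S) (s t : ℝ) (u : Fin S → ℝ) : Fin S → ℝ :=
  if u ⟨0, Nat.zero_lt_of_lt hpS⟩ = 0 then routeTo ⟨0, Nat.zero_lt_of_lt hpS⟩ s t u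
  else routeTo ⟨p, hpS⟩ s t u

/-- The map `Ψ^p` on vectors with `p` coordinates. -/
def PsiMap {p : ℕ} (s t : ℝ) (u : Fin p → ℝ) : Fin p → ℝ :=
  fun j =>
    if h : j.val + 1 < p then max (min (max (u j) s) (u ⟨j.val + 1, h⟩) - t) 0
    else max (max (u j) s - t) 0

/-- The map `Φ^p` on vectors with `S` coordinates, `p < S`. -/
def PhiMap {S p : ℕ} (hpS : p < S) (s t : ℝ) (u : Fin S → ℝ) : Fin S → ℝ :=
  fun j =>
    let x : ℝ :=
      if j.val < p then s
      else s + (if 0 < u ⟨0, Nat.zero_lt_of_lt hpS⟩ then u ⟨p, hpS⟩ else 0)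
    if h : j.val + 1 < S then max (min (max (u j) x) (u ⟨j.val + 1, h⟩) - t) 0
    else max (max (u j) x - t) 0

/-- `X` is a proper (real valued, with ordered nonnegative coordinates) random vector solving
`X ∘ θ = F(X)` almost surely, where `F` is a random map. -/
structure IsSolution {Ω : Type*} [MeasurableSpace Ω] (P : Measure Ω) (θ : Ω → Ω) {q : ℕ}
    (F : Ω → (Fin q → ℝ) → (Fin q → ℝ)) (X : Ω → Fin q → ℝ) : Prop where
  measurable : Measurable X
  ordered : ∀ ω, IsOrderedProfile (X ω)
  stationary : ∀ᵐ ω ∂P, X (θ ω) = F ω (X ω)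

/-- `X` solves `X ∘ θ = F(X)` and is almost surely coordinatewise below every other solution. -/
def IsMinimalSolution {Ω : Type*} [MeasurableSpace Ω] (P : Measure Ω) (θ : Ω → Ω) {q : ℕ}
    (F : Ω → (Fin q → ℝ) → (Fin q → ℝ)) (X : Ω → Fin q → ℝ) : Prop :=
  IsSolution P θ F X ∧ ∀ X', IsSolution P θ F X' → ∀ᵐ ω ∂P, ∀ i, X ω i ≤ X' ω i

end

end JSW

/-! Existence of the minimal solution is Loynes' argument. `PhiMap` is monotone and continuous along
sequences lying below their limit, so the recursion started from 0 at time `-n` increases with `n`,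
and its limit, once finite, is the minimal solution.

For finiteness, ergodicity makes each coordinate a.s. bounded or a.s. unbounded. Suppose some
coordinate explodes and let `k` be the least such index, counted from 0. Since the scheme increases
and `θ` preserves `P`, the increments of a sum of coordinates along the flow have nonnegative mean,
also in the limit (`integral_limit_increment_nonneg`). If `k < p`, coordinate `k` alone has limiting
drift at most `-τ`, which is absurd. If `k ≥ p`, the coordinates of rank at least `k` are summed:
the map inserts the level `x` among them, drops the smallest value, and lets each decrease by `τ`
(`sum_PhiMap_le`). For `k > p` the level stays bounded, so the drift is at most `-(S - k) τ`, again
absurd. For `k = p` the first `p` coordinates converge to a solution `Y` of the `Ψ^p` equation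
(`exists_psi_solution`), and the drift bound becomes `σ 1{Y(1) > 0} - (S - p) τ`, whose mean is
negative by hypothesis.

The map `GMap` is not monotone, so Loynes' scheme for it need not converge by monotonicity. But
`GMap ≤ PhiMap`, so that scheme stays below `V`. On the positive probability event of the statement,
any two profiles below `V` are merged by the next `S` arrivals (`trajectory_GMap_eq`). By ergodicity
this event occurs arbitrarily far in the past, so the scheme is eventually constant and its final
value is a solution. -/

namespace JSW

open scoped Topology

/-! ### The map `Φ^p` -/

/-- The level to which the `j`-th workload is raised by the map `Φ^p`. -/
noncomputable def phiLevel {S p : ℕ} (hpS : p < S) (s : ℝ) (u : Fin S → ℝ) (j : ℕ) : ℝ :=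
  if j < p then s else s + (if 0 < u ⟨0, Nat.zero_lt_of_lt hpS⟩ then u ⟨p, hpS⟩ else 0)

section PhiMap

variable {S p : ℕ} (hpS : p < S) {s t : ℝ} {u v : Fin S → ℝ}

theorem PhiMap_of_lt {j : Fin S} (h : j.val + 1 < S) :
    PhiMap hpS s t u j = max (min (max (u j) (phiLevel hpS s u j)) (u ⟨j.val + 1, h⟩) - t) 0 := by
  simp [PhiMap, phiLevel, h]

theorem PhiMap_of_not_lt {j : Fin S} (h : ¬ j.val + 1 < S) :
    PhiMap hpS s t u j = max (max (u j) (phiLevel hpS s u j) - t) 0 := by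
  simp [PhiMap, phiLevel, h]

theorem PhiMap_nonneg (j : Fin S) : 0 ≤ PhiMap hpS s t u j := by
  by_cases h : j.val + 1 < S
  · rw [PhiMap_of_lt hpS h]; exact le_max_right _ _
  · rw [PhiMap_of_not_lt hpS h]; exact le_max_right _ _

theorem phiLevel_mono (hu : ∀ i, 0 ≤ u i) (huv : u ≤ v) (j : ℕ) :
    phiLevel hpS s u j ≤ phiLevel hpS s v j := by
  have h0 := huv ⟨0, Nat.zero_lt_of_lt hpS⟩
  have hp := huv ⟨p, hpS⟩
  have hv := (hu ⟨p, hpS⟩).trans hp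
  unfold phiLevel
  split_ifs <;> linarith

theorem PhiMap_mono (hu : ∀ i, 0 ≤ u i) (huv : u ≤ v) :
    PhiMap hpS s t u ≤ PhiMap hpS s t v := by
  intro j
  have hx := phiLevel_mono hpS (s := s) hu huv j
  by_cases h : j.val + 1 < S
  · rw [PhiMap_of_lt hpS h, PhiMap_of_lt hpS h]
    have := huv j
    have := huv ⟨j.val + 1, h⟩
    gcongr
  · rw [PhiMap_of_not_lt hpS h, PhiMap_of_not_lt hpS h]
    have := huv j
    gcongr

theorem PhiMap_ordered (hu : IsOrderedProfile u) : IsOrderedProfile (PhiMap hpS s t u) := by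
  refine ⟨fun i j hij => ?_, PhiMap_nonneg hpS⟩
  rcases hij.eq_or_lt with rfl | hij
  · exact le_rfl
  have hi : i.val + 1 < S := lt_of_le_of_lt hij j.isLt
  rw [PhiMap_of_lt hpS hi]
  have h1 : u ⟨i.val + 1, hi⟩ ≤ u j := hu.1 (Fin.mk_le_of_le_val hij)
  by_cases hj : j.val + 1 < S
  · have h2 : u j ≤ u ⟨j.val + 1, hj⟩ := hu.1 (Fin.le_def.2 (Nat.le_succ _))
    rw [PhiMap_of_lt hpS hj]
    exact max_le_max (sub_le_sub_right
      ((min_le_right _ _).trans (h1.trans (le_min (le_max_left _ _) h2))) _) le_rfl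
  · rw [PhiMap_of_not_lt hpS hj]
    exact max_le_max (sub_le_sub_right
      ((min_le_right _ _).trans (h1.trans (le_max_left _ _))) _) le_rfl

theorem sub_le_PhiMap (hu : Monotone u) (j : Fin S) : u j - t ≤ PhiMap hpS s t u j := by
  by_cases h : j.val + 1 < S
  · rw [PhiMap_of_lt hpS h]
    have h2 : u j ≤ u ⟨j.val + 1, h⟩ := hu (Fin.le_def.2 (Nat.le_succ _))
    exact le_trans (sub_le_sub_right (le_min (le_max_left _ _) h2) _) (le_max_left _ _)
  · rw [PhiMap_of_not_lt hpS h]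
    exact le_trans (sub_le_sub_right (le_max_left _ _) _) (le_max_left _ _)

theorem PhiMap_le_max (j : Fin S) :
    PhiMap hpS s t u j ≤ max (max (u j) (phiLevel hpS s u j) - t) 0 := by
  by_cases h : j.val + 1 < S
  · rw [PhiMap_of_lt hpS h]
    gcongr
    exact min_le_left _ _
  · rw [PhiMap_of_not_lt hpS h]

theorem phiLevel_le (hu : IsOrderedProfile u) (j : ℕ) : phiLevel hpS s u j ≤ s + u ⟨p, hpS⟩ := by
  have := hu.2 ⟨p, hpS⟩
  unfold phiLevel
  split_ifs <;> linarith

theorem PhiMap_le_add_abs (hu : IsOrderedProfile u) (j : Fin S) :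
    PhiMap hpS s t u j ≤ u ⟨S - 1, by omega⟩ + |s| + |t| := by
  have hx := phiLevel_le hpS (s := s) hu j
  have hp : u ⟨p, hpS⟩ ≤ u ⟨S - 1, by omega⟩ := hu.1 (Fin.le_def.2 (by simp; omega))
  have hj : u j ≤ u ⟨S - 1, by omega⟩ := hu.1 (Fin.le_def.2 (by simp; omega))
  have h0 := hu.2 ⟨S - 1, by omega⟩
  refine (PhiMap_le_max hpS j).trans (max_le ?_ (by positivity))
  have hm : max (u j) (phiLevel hpS s u j) ≤ u ⟨S - 1, by omega⟩ + |s| :=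
    max_le (by linarith [abs_nonneg s]) (by linarith [le_abs_self s])
  linarith [neg_abs_le t]

/-- The indicator jumps at zero, so the level is continuous only from below: if the limit is
positive the indicator is eventually on, and otherwise `a n ≤ u` keeps it off for every `n`. -/
theorem tendsto_phiLevel {a : ℕ → Fin S → ℝ} (ha : ∀ n, a n ≤ u)
    (h0 : Tendsto (fun n => a n ⟨0, Nat.zero_lt_of_lt hpS⟩) atTop (𝓝 (u ⟨0, Nat.zero_lt_of_lt hpS⟩)))
    (hp : Tendsto (fun n => a n ⟨p, hpS⟩) atTop (𝓝 (u ⟨p, hpS⟩))) (j : ℕ) :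
    Tendsto (fun n => phiLevel hpS s (a n) j) atTop (𝓝 (phiLevel hpS s u j)) := by
  unfold phiLevel
  by_cases hj : j < p
  · simp [hj]
  simp only [hj, if_false]
  refine tendsto_const_nhds.add ?_
  by_cases hu : 0 < u ⟨0, Nat.zero_lt_of_lt hpS⟩
  · rw [if_pos hu]
    refine hp.congr' ?_
    filter_upwards [h0.eventually_const_lt hu] with n hn
    rw [if_pos hn]
  · rw [if_neg hu]
    refine tendsto_const_nhds.congr fun n => ?_
    rw [if_neg fun h => hu (h.trans_le (ha n _))]

theorem tendsto_PhiMap {a : ℕ → Fin S → ℝ} (ha : ∀ n, a n ≤ u)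
    (hlim : ∀ i, Tendsto (fun n => a n i) atTop (𝓝 (u i))) (j : Fin S) :
    Tendsto (fun n => PhiMap hpS s t (a n) j) atTop (𝓝 (PhiMap hpS s t u j)) := by
  have hx := tendsto_phiLevel hpS (s := s) ha (hlim _) (hlim _) j
  by_cases h : j.val + 1 < S
  · simp only [PhiMap_of_lt hpS h]
    exact ((((hlim j).max hx).min (hlim _)).sub_const t).max tendsto_const_nhds
  · simp only [PhiMap_of_not_lt hpS h]
    exact (((hlim j).max hx).sub_const t).max tendsto_const_nhds

theorem measurable_PhiMap {Ω : Type*} [MeasurableSpace Ω] {f g : Ω → ℝ} {X : Ω → Fin S → ℝ}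
    (hf : Measurable f) (hg : Measurable g) (hX : Measurable X) :
    Measurable fun ω => PhiMap hpS (f ω) (g ω) (X ω) := by
  have hXi : ∀ i, Measurable fun ω => X ω i := fun i => (measurable_pi_apply i).comp hX
  have hx : ∀ j : ℕ, Measurable fun ω => phiLevel hpS (f ω) (X ω) j := by
    intro j
    unfold phiLevel
    by_cases hj : j < p
    · simpa [hj] using hf
    · simp only [hj, if_false]
      exact hf.add (Measurable.ite (measurableSet_lt measurable_const (hXi _)) (hXi _)
        measurable_const)
  refine measurable_pi_iff.2 fun j => ?_
  by_cases h : j.val + 1 < S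
  · simp only [PhiMap_of_lt hpS h]
    exact ((((hXi j).max (hx j)).min (hXi _)).sub hg).max measurable_const
  · simp only [PhiMap_of_not_lt hpS h]
    exact (((hXi j).max (hx j)).sub hg).max measurable_const

/-- Raising the largest workloads to a common level `x` and shifting them by one rank amounts to
inserting `x` and removing the smallest of them. -/
theorem sum_PhiMap_le (hu : IsOrderedProfile u) {k : ℕ} (hpk : p ≤ k) (hk : k < S) :
    ∑ j ∈ Finset.univ.filter (fun j : Fin S => k ≤ j.val), PhiMap hpS s t u j ≤
      ∑ j ∈ Finset.univ.filter (fun j : Fin S => k ≤ j.val), u j +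
        (max (phiLevel hpS s u k - u ⟨k, hk⟩) 0 - ((S : ℝ) - k) * min t (u ⟨k, hk⟩)) := by
  set x := phiLevel hpS s u k with hx
  -- `r j` is the excess of the level over `u j`, set to 0 past the last rank so that the sum of `r
  -- j - r (j + 1)` telescopes to `r k`. The decrease is `min t (u k)` and not `t` because of the
  -- truncation at 0.
  set r : ℕ → ℝ := fun j => if h : j < S then max (x - u ⟨j, h⟩) 0 else 0 with hr
  have key : ∀ j : Fin S, k ≤ j.val →
      PhiMap hpS s t u j ≤ u j + ((r j - r (j + 1)) - min t (u ⟨k, hk⟩)) := by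
    intro j hj
    have hxj : phiLevel hpS s u j = x := by
      simp [hx, phiLevel, not_lt.2 hpk, not_lt.2 (hpk.trans hj)]
    have hkj : u ⟨k, hk⟩ ≤ u j := hu.1 (Fin.le_def.2 hj)
    have hrj : r j = max (x - u j) 0 := by simp [hr]
    have hm1 := min_le_left t (u ⟨k, hk⟩)
    have hm2 := min_le_right t (u ⟨k, hk⟩)
    by_cases h : j.val + 1 < S
    · have hjj : u j ≤ u ⟨j.val + 1, h⟩ := hu.1 (Fin.le_def.2 (Nat.le_succ _))
      have hrj' : r (j + 1) = max (x - u ⟨j.val + 1, h⟩) 0 := by simp [hr, h]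
      -- For `a ≤ b`, `min (max a x) b = a + (x - a)⁺ - (x - b)⁺`.
      have hmin : min (max (u j) x) (u ⟨j.val + 1, h⟩) = u j + (r j - r (j + 1)) := by
        rw [hrj, hrj']
        rcases le_total x (u j) with h1 | h1 <;> rcases le_total x (u ⟨j.val + 1, h⟩) with h2 | h2 <;>
          (simp [h1, h2, hjj]; try linarith)
      have hge : u j ≤ u j + (r j - r (j + 1)) := by
        rw [← hmin]; exact le_min (le_max_left _ _) hjj
      rw [PhiMap_of_lt hpS h, hxj, hmin]
      exact max_le (by linarith) (by linarith)
    · have hrj' : r (j + 1) = 0 := by simp [hr, h]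
      have hmax : max (u j) x = u j + r j := by
        rw [hrj]
        rcases le_total x (u j) with h1 | h1 <;> simp [h1]
      have hge : u j ≤ u j + r j := by rw [← hmax]; exact le_max_left _ _
      rw [PhiMap_of_not_lt hpS h, hxj, hmax, hrj']
      exact max_le (by linarith) (by linarith)
  refine (Finset.sum_le_sum fun j hj => key j (Finset.mem_filter.1 hj).2).trans ?_
  have hsum : ∀ f : ℕ → ℝ, ∑ j ∈ Finset.univ.filter (fun j : Fin S => k ≤ j.val), f j =
      ∑ j ∈ Finset.Ico k S, f j := by
    intro f
    refine Finset.sum_bij (fun j _ => j.val) (by simp) (fun _ _ _ _ => Fin.ext) ?_ (by simp)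
    intro b hb
    rw [Finset.mem_Ico] at hb
    exact ⟨⟨b, hb.2⟩, by simp [hb.1], rfl⟩
  have htel : ∑ j ∈ Finset.Ico k S, (r j - r (j + 1)) = r k := by
    have := Finset.sum_Ico_sub r hk.le
    rw [← neg_inj, ← Finset.sum_neg_distrib]
    simp only [neg_sub]
    rw [this]
    simp [hr]
  rw [Finset.sum_add_distrib]
  refine add_le_add le_rfl (le_of_eq ?_)
  rw [hsum fun j => r j - r (j + 1) - min t (u ⟨k, hk⟩), Finset.sum_sub_distrib, htel]
  simp [hr, hk, Nat.cast_sub hk.le]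

end PhiMap

/-! ### Loynes' scheme -/

/-- The value at time `0` of the recursion driven by `F` and started from `0` at time `-n`. -/
def loynes {Ω : Type*} [MeasurableSpace Ω] (θ : Ω ≃ᵐ Ω) {q : ℕ}
    (F : Ω → (Fin q → ℝ) → (Fin q → ℝ)) : ℕ → Ω → Fin q → ℝ
  | 0, _ => 0
  | n + 1, ω => F (θ.symm ω) (loynes θ F n (θ.symm ω))

section Loynes

variable {Ω : Type*} [MeasurableSpace Ω] {P : Measure Ω} {θ : Ω ≃ᵐ Ω} {q : ℕ}
  {F : Ω → (Fin q → ℝ) → (Fin q → ℝ)}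

theorem isOrderedProfile_zero : IsOrderedProfile (0 : Fin q → ℝ) :=
  ⟨fun _ _ _ => le_rfl, fun _ => le_rfl⟩

theorem loynes_succ_apply (n : ℕ) (ω : Ω) :
    loynes θ F (n + 1) (θ ω) = F ω (loynes θ F n ω) := by
  simp [loynes]

theorem loynes_ordered (hF : ∀ ω u, IsOrderedProfile u → IsOrderedProfile (F ω u)) (n : ℕ) (ω : Ω) :
    IsOrderedProfile (loynes θ F n ω) := by
  induction n generalizing ω with
  | zero => exact isOrderedProfile_zero
  | succ n ih => exact hF _ _ (ih _)

theorem measurable_loynes (hF : ∀ X, Measurable X → Measurable fun ω => F ω (X ω)) (n : ℕ) :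
    Measurable (loynes θ F n) := by
  induction n with
  | zero => exact measurable_const
  | succ n ih => exact (hF _ ih).comp θ.symm.measurable

/-- Starting one step earlier gives a nonnegative profile where the later start has 0, and monotone
maps preserve this order. -/
theorem loynes_mono (hF : ∀ ω u, IsOrderedProfile u → IsOrderedProfile (F ω u))
    (hmono : ∀ ω u v, (∀ i, 0 ≤ u i) → u ≤ v → F ω u ≤ F ω v) (ω : Ω) :
    Monotone fun n => loynes θ F n ω := by
  refine monotone_nat_of_le_succ fun n => ?_
  induction n generalizing ω with
  | zero => exact (loynes_ordered hF 1 ω).2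
  | succ n ih => exact hmono _ _ _ (loynes_ordered hF n _).2 (ih _)

theorem ae_forall_iterate_symm (hθ : MeasurePreserving θ P P) {Q : Ω → Prop}
    (hQ : ∀ᵐ ω ∂P, Q ω) : ∀ᵐ ω ∂P, ∀ n : ℕ, Q (θ.symm^[n] ω) :=
  ae_all_iff.2 fun n => ((hθ.symm.iterate n).quasiMeasurePreserving).ae hQ

/-- If `F` is dominated by a map `F'`, the Loynes scheme of `F` stays below solutions for `F'`. -/
theorem ae_loynes_le (hθ : MeasurePreserving θ P P) {F' : Ω → (Fin q → ℝ) → (Fin q → ℝ)}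
    (hF : ∀ ω u, IsOrderedProfile u → IsOrderedProfile (F ω u))
    (hmono : ∀ᵐ ω ∂P, ∀ u v, IsOrderedProfile u → IsOrderedProfile v → u ≤ v → F ω u ≤ F' ω v)
    {X : Ω → Fin q → ℝ} (hX : IsSolution P θ F' X) :
    ∀ᵐ ω ∂P, ∀ n, loynes θ F n ω ≤ X ω := by
  refine ae_all_iff.2 fun n => ?_
  induction n with
  | zero => exact ae_of_all _ fun ω => (hX.ordered ω).2
  | succ n ih =>
    filter_upwards [hθ.symm.quasiMeasurePreserving.ae (ih.and (hmono.and hX.stationary))]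
      with ω ⟨h1, h2, h3⟩
    have := h2 _ _ (loynes_ordered hF n _) (hX.ordered _) h1
    rwa [← h3, θ.apply_symm_apply] at this

/-- The limit of the Loynes scheme, where it is finite. -/
noncomputable def loynesLimit (θ : Ω ≃ᵐ Ω) (F : Ω → (Fin q → ℝ) → (Fin q → ℝ)) (ω : Ω) :
    Fin q → ℝ :=
  open Classical in
  if ∀ i, BddAbove (Set.range fun n => loynes θ F n ω i) then fun i => ⨆ n, loynes θ F n ω i else 0

theorem isMinimalSolution_loynesLimit (hθ : MeasurePreserving θ P P)
    (hF : ∀ ω u, IsOrderedProfile u → IsOrderedProfile (F ω u))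
    (hmono : ∀ ω u v, (∀ i, 0 ≤ u i) → u ≤ v → F ω u ≤ F ω v)
    (hmeas : ∀ X, Measurable X → Measurable fun ω => F ω (X ω))
    (hcont : ∀ ω (a : ℕ → Fin q → ℝ) u, (∀ n, a n ≤ u) →
      (∀ i, Tendsto (fun n => a n i) atTop (𝓝 (u i))) →
      ∀ i, Tendsto (fun n => F ω (a n) i) atTop (𝓝 (F ω u i)))
    (hbdd : ∀ᵐ ω ∂P, ∀ i, BddAbove (Set.range fun n => loynes θ F n ω i)) :
    IsMinimalSolution P θ F (loynesLimit θ F) := by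
  have hm : ∀ n i, Measurable fun ω => loynes θ F n ω i := fun n i =>
    (measurable_pi_apply i).comp (measurable_loynes hmeas n)
  have hlim : ∀ ω, (∀ i, BddAbove (Set.range fun n => loynes θ F n ω i)) →
      ∀ i, Tendsto (fun n => loynes θ F n ω i) atTop (𝓝 (loynesLimit θ F ω i)) := by
    intro ω hω i
    simp only [loynesLimit, if_pos hω]
    exact tendsto_atTop_ciSup (fun m n h => loynes_mono hF hmono ω h i) (hω i)
  have hle : ∀ ω, (∀ i, BddAbove (Set.range fun n => loynes θ F n ω i)) →
      ∀ n, loynes θ F n ω ≤ loynesLimit θ F ω := by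
    intro ω hω n i
    simp only [loynesLimit, if_pos hω]
    exact le_ciSup (hω i) n
  refine ⟨⟨?_, ?_, ?_⟩, ?_⟩
  · refine Measurable.ite ?_ (measurable_pi_iff.2 fun i => .iSup fun n => hm n i) measurable_const
    have : {ω | ∀ i, BddAbove (Set.range fun n => loynes θ F n ω i)} =
        ⋂ i, {ω | BddAbove (Set.range fun n => loynes θ F n ω i)} := by
      ext; simp
    rw [this]
    exact MeasurableSet.iInter fun i => measurableSet_bddAbove_range fun n => hm n i
  · intro ω
    by_cases hω : ∀ i, BddAbove (Set.range fun n => loynes θ F n ω i)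
    · exact ⟨fun i j hij => le_of_tendsto_of_tendsto' (hlim ω hω i) (hlim ω hω j)
        fun n => (loynes_ordered hF n ω).1 hij,
        fun i => ge_of_tendsto' (hlim ω hω i) fun n => (loynes_ordered hF n ω).2 i⟩
    · simpa only [loynesLimit, if_neg hω] using isOrderedProfile_zero
  · filter_upwards [hbdd, hθ.quasiMeasurePreserving.ae hbdd] with ω h1 h2
    funext i
    have := (hlim _ h2 i).comp (tendsto_add_atTop_nat 1)
    refine tendsto_nhds_unique this ?_
    simpa only [Function.comp_def, loynes_succ_apply] using hcont ω _ _ (hle ω h1) (hlim ω h1) i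
  · intro X hX
    filter_upwards [ae_loynes_le hθ hF (ae_of_all _ fun ω u v hu _ huv => hmono ω u v hu.2 huv) hX,
      hbdd] with ω h1 h2 i
    exact le_of_tendsto' (hlim ω h2 i) fun n => h1 n i

/-- A nondecreasing sequence of integrable functions has increments of nonnegative mean along the
flow, and this persists in the limit. -/
theorem integral_limit_increment_nonneg [IsFiniteMeasure P] (hθ : MeasurePreserving θ P P)
    {f D : ℕ → Ω → ℝ} {g h : Ω → ℝ} (hf : ∀ n, Integrable (f n) P)
    (hmono : ∀ n, f n ≤ f (n + 1)) (hDm : ∀ n, AEStronglyMeasurable (D n) P)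
    (hD : ∀ᵐ ω ∂P, ∀ n, f (n + 1) (θ ω) ≤ f n ω + D n ω)
    (hh : Integrable h P) (hDh : ∀ᵐ ω ∂P, ∀ n, |D n ω| ≤ h ω)
    (hlim : ∀ᵐ ω ∂P, Tendsto (fun n => D n ω) atTop (𝓝 (g ω))) : 0 ≤ ∫ ω, g ω ∂P := by
  have hDh' : ∀ n, ∀ᵐ ω ∂P, ‖D n ω‖ ≤ h ω := fun n => hDh.mono fun ω hω => hω n
  have hDi : ∀ n, Integrable (D n) P := fun n => hh.mono' (hDm n) (hDh' n)
  refine ge_of_tendsto' (tendsto_integral_of_dominated_convergence h hDm hh hDh' hlim) fun n => ?_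
  -- Invariance of `P` turns the pointwise bound into `∫ f (n + 1) ≤ ∫ f n + ∫ D n`; as `f`
  -- increases with `n`, `∫ D n ≥ 0`.
  have h1 : ∫ ω, f (n + 1) (θ ω) ∂P = ∫ ω, f (n + 1) ω ∂P :=
    hθ.integral_comp θ.measurableEmbedding _
  have h2 : ∫ ω, f (n + 1) (θ ω) ∂P ≤ ∫ ω, (f n ω + D n ω) ∂P :=
    integral_mono_ae ((hθ.integrable_comp_emb θ.measurableEmbedding).2 (hf (n + 1)))
      ((hf n).add (hDi n)) (hD.mono fun ω hω => hω n)
  rw [integral_add (hf n) (hDi n)] at h2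
  have h3 : ∫ ω, f n ω ∂P ≤ ∫ ω, f (n + 1) ω ∂P := integral_mono (hf n) (hf (n + 1)) (hmono n)
  linarith

/-- The Loynes scheme is almost surely bounded or almost surely unbounded. -/
theorem ae_bddAbove_or_ae_not_bddAbove [IsFiniteMeasure P] (hθ : Ergodic θ P)
    (hmeas : ∀ X, Measurable X → Measurable fun ω => F ω (X ω)) {t : Ω → ℝ} (i : Fin q)
    (ht : ∀ n ω, loynes θ F n ω i - t ω ≤ F ω (loynes θ F n ω) i) :
    (∀ᵐ ω ∂P, BddAbove (Set.range fun n => loynes θ F n ω i)) ∨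
      ∀ᵐ ω ∂P, ¬ BddAbove (Set.range fun n => loynes θ F n ω i) := by
  set s : Set Ω := {ω | BddAbove (Set.range fun n => loynes θ F n ω i)} with hs_def
  have hs : MeasurableSet s := measurableSet_bddAbove_range fun n =>
    (measurable_pi_apply i).comp (measurable_loynes hmeas n)
  -- One step lowers coordinate `i` by at most `t ω`, so a bound at `θ ω` gives one at `ω`.
  have hsub : θ ⁻¹' s ⊆ s := by
    rintro ω ⟨c, hc⟩
    refine ⟨c + t ω, ?_⟩
    rintro _ ⟨n, rfl⟩
    have h1 := hc ⟨n + 1, rfl⟩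
    simp only [loynes_succ_apply] at h1
    linarith [ht n ω]
  rcases hθ.ae_empty_or_univ_of_preimage_ae_le hs.nullMeasurableSet hsub.eventuallyLE with h | h
  · exact Or.inr (eventuallyEq_empty.1 h)
  · exact Or.inl (eventuallyEq_univ.1 h)

end Loynes

/-! ### Finiteness of the Loynes scheme of `Φ^p` -/

section Stability

variable {Ω : Type*} [MeasurableSpace Ω] {P : Measure Ω} {θ : Ω ≃ᵐ Ω} {σ τ : Ω → ℝ} {S p : ℕ}

/-- The Loynes scheme of the equation driven by `Φ^p`. -/
noncomputable abbrev phiLoynes (θ : Ω ≃ᵐ Ω) (σ τ : Ω → ℝ) (hpS : p < S) : ℕ → Ω → Fin S → ℝ :=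
  loynes θ fun ω => PhiMap hpS (σ ω) (τ ω)

theorem phiLoynes_ordered (hpS : p < S) (n : ℕ) (ω : Ω) :
    IsOrderedProfile (phiLoynes θ σ τ hpS n ω) :=
  loynes_ordered (fun _ _ => PhiMap_ordered hpS) n ω

theorem phiLoynes_mono (hpS : p < S) (ω : Ω) : Monotone fun n => phiLoynes θ σ τ hpS n ω :=
  loynes_mono (F := fun ω => PhiMap hpS (σ ω) (τ ω)) (fun _ _ => PhiMap_ordered hpS)
    (fun _ _ _ => PhiMap_mono hpS) ω

theorem measurable_phiLoynes_apply (hσm : Measurable σ) (hτm : Measurable τ) (hpS : p < S)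
    (n : ℕ) (i : Fin S) : Measurable fun ω => phiLoynes θ σ τ hpS n ω i :=
  (measurable_pi_apply i).comp
    (measurable_loynes (fun _ hX => measurable_PhiMap hpS hσm hτm hX) n)

theorem integrable_phiLoynes (hθ : MeasurePreserving θ P P) (hσm : Measurable σ)
    (hτm : Measurable τ) (hσi : Integrable σ P) (hτi : Integrable τ P) (hpS : p < S) (n : ℕ)
    (i : Fin S) : Integrable (fun ω => phiLoynes θ σ τ hpS n ω i) P := by
  induction n generalizing i with
  | zero => exact integrable_zero _ _ _
  | succ n ih =>
    have h1 : Integrable (fun ω => phiLoynes θ σ τ hpS n ω ⟨S - 1, by omega⟩ + |σ ω| + |τ ω|) P :=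
      ((ih _).add hσi.abs).add hτi.abs
    have h2 := (hθ.symm.integrable_comp_emb θ.symm.measurableEmbedding).2 h1
    refine h2.mono' (measurable_phiLoynes_apply hσm hτm hpS (n + 1) i).aestronglyMeasurable ?_
    refine ae_of_all _ fun ω => ?_
    rw [Real.norm_of_nonneg ((phiLoynes_ordered hpS (n + 1) ω).2 i)]
    exact PhiMap_le_add_abs hpS (phiLoynes_ordered hpS n _) i

theorem tendsto_phiLoynes_atTop {hpS : p < S} {ω : Ω} {i : Fin S}
    (h : ¬ BddAbove (Set.range fun n => phiLoynes θ σ τ hpS n ω i)) :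
    Tendsto (fun n => phiLoynes θ σ τ hpS n ω i) atTop atTop :=
  tendsto_atTop_atTop_of_monotone' (fun _ _ hmn => phiLoynes_mono hpS ω hmn i) h

theorem integral_pos_of_ae_pos [IsProbabilityMeasure P] {f : Ω → ℝ} (hf : Integrable f P)
    (hpos : ∀ᵐ ω ∂P, 0 < f ω) : 0 < ∫ ω, f ω ∂P := by
  refine (integral_pos_iff_support_of_nonneg_ae (hpos.mono fun _ => le_of_lt) hf).2 ?_
  have : Function.support f =ᵐ[P] Set.univ := eventuallyEq_univ.2 (hpos.mono fun _ h => h.ne')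
  rw [measure_congr this]
  simp

/-- The workloads of the `p` least loaded servers remain bounded. -/
theorem not_ae_phiLoynes_unbounded_of_lt [IsProbabilityMeasure P] (hθ : MeasurePreserving θ P P)
    (hσm : Measurable σ) (hτm : Measurable τ) (hσi : Integrable σ P) (hτi : Integrable τ P)
    (hσ : ∀ᵐ ω ∂P, 0 ≤ σ ω) (hτ : ∀ᵐ ω ∂P, 0 < τ ω) (hpS : p < S) {i : Fin S} (hi : i.val < p) :
    ¬ ∀ᵐ ω ∂P, ¬ BddAbove (Set.range fun n => phiLoynes θ σ τ hpS n ω i) := by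
  intro hunb
  have hmeas := fun n => measurable_phiLoynes_apply (θ := θ) hσm hτm hpS n i
  have hpos := integral_pos_of_ae_pos hτi hτ
  -- `D` drops the minimum with the next coordinate, which only increases it. Once coordinate `i`
  -- exceeds both `σ` and `τ`, `D` equals `-τ`.
  have := integral_limit_increment_nonneg (P := P) hθ
    (f := fun n ω => phiLoynes θ σ τ hpS n ω i)
    (D := fun n ω => max (max (phiLoynes θ σ τ hpS n ω i) (σ ω) - τ ω) 0
      - phiLoynes θ σ τ hpS n ω i)
    (g := fun ω => - τ ω) (h := fun ω => σ ω + τ ω)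
    (integrable_phiLoynes hθ hσm hτm hσi hτi hpS · i)
    (fun n ω => phiLoynes_mono hpS ω n.le_succ i)
    (fun n => (((((hmeas n).max hσm).sub hτm).max measurable_const).sub
      (hmeas n)).aestronglyMeasurable) ?_ (hσi.add hτi) ?_ ?_
  · rw [integral_neg] at this
    linarith
  · refine ae_of_all _ fun ω n => ?_
    have h1 : phiLoynes θ σ τ hpS (n + 1) (θ ω) i = _ :=
      congrFun (loynes_succ_apply (θ := θ) n ω) i
    have h2 := PhiMap_le_max hpS (s := σ ω) (t := τ ω) (u := phiLoynes θ σ τ hpS n ω) i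
    rw [phiLevel, if_pos hi] at h2
    simp only [h1]
    linarith
  · filter_upwards [hσ, hτ] with ω h1 h2 n
    have h0 := (phiLoynes_ordered (θ := θ) (σ := σ) (τ := τ) hpS n ω).2 i
    generalize phiLoynes θ σ τ hpS n ω i = u at *
    rw [abs_le]
    constructor
    · linarith [le_max_left (max u (σ ω) - τ ω) 0, le_max_left u (σ ω)]
    · have : max u (σ ω) ≤ u + σ ω := max_le (by linarith) (by linarith)
      linarith [max_le (a := max u (σ ω) - τ ω) (b := 0) (c := u + σ ω) (by linarith)
        (by linarith)]
  · filter_upwards [hunb] with ω hω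
    have hlim := tendsto_phiLoynes_atTop hω
    refine tendsto_const_nhds.congr' ?_
    filter_upwards [hlim.eventually_ge_atTop (σ ω), hlim.eventually_ge_atTop (τ ω)] with n h1 h2
    rw [max_eq_left h1, max_eq_left (by linarith)]
    ring

/-- The limit of the `p` smallest workloads when the next one explodes solves the equation driven by
`Ψ^p`. -/
theorem exists_psi_solution (hθ : MeasurePreserving θ P P) (hσm : Measurable σ)
    (hτm : Measurable τ) (hpS : p < S)
    (hbdd : ∀ᵐ ω ∂P, ∀ i : Fin S, i.val < p →
      BddAbove (Set.range fun n => phiLoynes θ σ τ hpS n ω i))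
    (hunb : ∀ᵐ ω ∂P, ¬ BddAbove (Set.range fun n => phiLoynes θ σ τ hpS n ω ⟨p, hpS⟩)) :
    ∃ Y : Ω → Fin p → ℝ, IsSolution P θ (fun ω => PsiMap (σ ω) (τ ω)) Y ∧
      ∀ᵐ ω ∂P, ∀ i : Fin p,
        Tendsto (fun n => phiLoynes θ σ τ hpS n ω (Fin.castLE hpS.le i)) atTop (𝓝 (Y ω i)) := by
  classical
  let B : Ω → Prop := fun ω => ∀ i : Fin p,
    BddAbove (Set.range fun n => phiLoynes θ σ τ hpS n ω (Fin.castLE hpS.le i))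
  have hB : ∀ᵐ ω ∂P, B ω := hbdd.mono fun ω h i => h _ i.isLt
  let Y : Ω → Fin p → ℝ := fun ω =>
    if B ω then fun i => ⨆ n, phiLoynes θ σ τ hpS n ω (Fin.castLE hpS.le i) else 0
  have hlim : ∀ ω, B ω → ∀ i : Fin p,
      Tendsto (fun n => phiLoynes θ σ τ hpS n ω (Fin.castLE hpS.le i)) atTop (𝓝 (Y ω i)) := by
    intro ω hω i
    simp only [Y, if_pos hω]
    exact tendsto_atTop_ciSup (fun m n h => phiLoynes_mono hpS ω h _) (hω i)
  have hmeas := fun n i => measurable_phiLoynes_apply (θ := θ) hσm hτm hpS n i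
  refine ⟨Y, ⟨?_, ?_, ?_⟩, hB.mono hlim⟩
  · refine Measurable.ite ?_ (measurable_pi_iff.2 fun i => .iSup fun n => hmeas n _)
      measurable_const
    have : {ω | B ω} = ⋂ i : Fin p,
        {ω | BddAbove (Set.range fun n => phiLoynes θ σ τ hpS n ω (Fin.castLE hpS.le i))} := by
      ext; simp [B]
    rw [this]
    exact MeasurableSet.iInter fun i => measurableSet_bddAbove_range fun n => hmeas n _
  · intro ω
    by_cases hω : B ω
    · exact ⟨fun i j hij => le_of_tendsto_of_tendsto' (hlim ω hω i) (hlim ω hω j)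
        fun n => (phiLoynes_ordered hpS n ω).1 (Fin.le_def.2 hij),
        fun i => ge_of_tendsto' (hlim ω hω i) fun n => (phiLoynes_ordered hpS n ω).2 _⟩
    · simpa only [Y, if_neg hω] using isOrderedProfile_zero
  · filter_upwards [hB, hθ.quasiMeasurePreserving.ae hB, hunb] with ω h1 h2 h3
    funext i
    have hl := (hlim _ h2 i).comp (tendsto_add_atTop_nat 1)
    refine tendsto_nhds_unique hl ?_
    have hi : (Fin.castLE hpS.le i).val + 1 < S := lt_of_le_of_lt i.isLt hpS
    have hx : ∀ n, phiLevel hpS (σ ω) (phiLoynes θ σ τ hpS n ω) (Fin.castLE hpS.le i).val = σ ω :=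
      fun n => if_pos i.isLt
    have hstep : ∀ n, phiLoynes θ σ τ hpS (n + 1) (θ ω) (Fin.castLE hpS.le i) =
        max (min (max (phiLoynes θ σ τ hpS n ω (Fin.castLE hpS.le i)) (σ ω))
          (phiLoynes θ σ τ hpS n ω ⟨i.val + 1, hi⟩) - τ ω) 0 := by
      intro n
      have h := congrFun (loynes_succ_apply (θ := θ)
        (F := fun ω => PhiMap hpS (σ ω) (τ ω)) n ω) (Fin.castLE hpS.le i)
      rw [PhiMap_of_lt hpS hi, hx] at h
      exact h
    simp only [Function.comp_def, hstep]
    have hmax := (hlim ω h1 i).max (tendsto_const_nhds (x := σ ω))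
    by_cases hip : i.val + 1 < p
    · simp only [PsiMap, hip, dif_pos]
      exact ((hmax.min (hlim ω h1 ⟨i.val + 1, hip⟩)).sub_const _).max tendsto_const_nhds
    · simp only [PsiMap, hip, dif_neg, not_false_eq_true]
      refine (Tendsto.sub_const ?_ _).max tendsto_const_nhds
      -- The neighbour of the last retained coordinate explodes, so the minimum with it eventually
      -- disappears, leaving the last case of `PsiMap`.
      have hlast : (⟨i.val + 1, hi⟩ : Fin S) = ⟨p, hpS⟩ := Fin.ext (by simp; omega)
      rw [hlast]
      refine hmax.congr' ?_
      filter_upwards [hmax.eventually_lt_const (lt_add_one _),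
        (tendsto_phiLoynes_atTop h3).eventually_ge_atTop (max (Y ω i) (σ ω) + 1)] with n h4 h5
      exact (min_eq_left (h4.le.trans h5)).symm

/-- Under the stability condition the Loynes scheme of `Φ^p` is almost surely bounded. -/
theorem ae_bddAbove_phiLoynes [IsProbabilityMeasure P] (hθ : Ergodic θ P)
    (hσm : Measurable σ) (hτm : Measurable τ) (hσi : Integrable σ P) (hτi : Integrable τ P)
    (hσ : ∀ᵐ ω ∂P, 0 ≤ σ ω) (hτ : ∀ᵐ ω ∂P, 0 < τ ω) (hp : 0 < p) (hpS : p < S)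
    (hY : ∀ Y : Ω → Fin p → ℝ, IsSolution P θ (fun ω => PsiMap (σ ω) (τ ω)) Y →
      ∫ ω, {ω' | 0 < Y ω' ⟨0, hp⟩}.indicator σ ω ∂P < ((S : ℝ) - (p : ℝ)) * ∫ ω, τ ω ∂P) :
    ∀ᵐ ω ∂P, ∀ i, BddAbove (Set.range fun n => phiLoynes θ σ τ hpS n ω i) := by
  have hθ' := hθ.toMeasurePreserving
  have hmeas := fun n i => measurable_phiLoynes_apply (θ := θ) hσm hτm hpS n i
  have h01 := fun i => ae_bddAbove_or_ae_not_bddAbove (P := P) (θ := θ)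
    (F := fun ω => PhiMap hpS (σ ω) (τ ω)) hθ
    (fun _ hX => measurable_PhiMap hpS hσm hτm hX) (t := τ) i
    fun n ω => sub_le_PhiMap hpS (phiLoynes_ordered hpS n ω).1 i
  by_contra hcon
  have hex : ∃ k : ℕ, ∃ h : k < S,
      ∀ᵐ ω ∂P, ¬ BddAbove (Set.range fun n => phiLoynes θ σ τ hpS n ω ⟨k, h⟩) := by
    by_contra! hne
    exact hcon (ae_all_iff.2 fun i => (h01 i).resolve_right (hne i i.isLt))
  classical
  obtain ⟨hk, hunb⟩ := Nat.find_spec hex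
  have hmin := fun m hm => Nat.find_min hex (m := m) hm
  generalize Nat.find hex = k at hk hunb hmin
  have hpk : p ≤ k := by
    by_contra! hkp
    exact not_ae_phiLoynes_unbounded_of_lt hθ' hσm hτm hσi hτi hσ hτ hpS (i := ⟨k, hk⟩) hkp hunb
  have hbdd : ∀ᵐ ω ∂P, ∀ i : Fin S, i.val < k →
      BddAbove (Set.range fun n => phiLoynes θ σ τ hpS n ω i) := by
    refine ae_all_iff.2 fun i => ?_
    by_cases hi : i.val < k
    · filter_upwards [(h01 i).resolve_right fun h => hmin i hi ⟨i.isLt, h⟩] with ω hω _ using hω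
    · exact ae_of_all _ fun ω h => absurd h hi
  have hpos := integral_pos_of_ae_pos hτi hτ
  have hkS : (k : ℝ) < S := by exact_mod_cast hk
  have hxm : ∀ n, Measurable fun ω => phiLevel hpS (σ ω) (phiLoynes θ σ τ hpS n ω) k := by
    intro n
    unfold phiLevel
    simp only [not_lt.2 hpk, if_false]
    exact hσm.add (Measurable.ite (measurableSet_lt measurable_const (hmeas n _)) (hmeas n _)
      measurable_const)
  -- The mean drift of the sum of the exploding workloads is nonnegative.
  have hdrift : ∀ g : Ω → ℝ, (∀ᵐ ω ∂P, Tendsto (fun n =>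
      max (phiLevel hpS (σ ω) (phiLoynes θ σ τ hpS n ω) k - phiLoynes θ σ τ hpS n ω ⟨k, hk⟩) 0)
        atTop (𝓝 (g ω))) →
      0 ≤ ∫ ω, (g ω - ((S : ℝ) - k) * τ ω) ∂P := by
    intro g hg
    refine integral_limit_increment_nonneg (P := P) hθ'
      (f := fun n ω => ∑ j ∈ Finset.univ.filter (fun j : Fin S => k ≤ j.val),
        phiLoynes θ σ τ hpS n ω j)
      (D := fun n ω =>
        max (phiLevel hpS (σ ω) (phiLoynes θ σ τ hpS n ω) k - phiLoynes θ σ τ hpS n ω ⟨k, hk⟩) 0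
          - ((S : ℝ) - k) * min (τ ω) (phiLoynes θ σ τ hpS n ω ⟨k, hk⟩))
      (h := fun ω => σ ω + ((S : ℝ) - k) * τ ω)
      (fun n => integrable_finsetSum _ fun j _ => integrable_phiLoynes hθ' hσm hτm hσi hτi hpS n j)
      (fun n ω => Finset.sum_le_sum fun j _ => phiLoynes_mono hpS ω n.le_succ j)
      (fun n => ((((hxm n).sub (hmeas n _)).max measurable_const).sub
        ((hτm.min (hmeas n _)).const_mul _)).aestronglyMeasurable) ?_
      (hσi.add (hτi.const_mul _)) ?_ ?_
    · refine ae_of_all _ fun ω n => ?_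
      have h1 : phiLoynes θ σ τ hpS (n + 1) (θ ω) = _ := loynes_succ_apply (θ := θ) n ω
      simp only [h1]
      exact sum_PhiMap_le hpS (phiLoynes_ordered hpS n ω) hpk hk
    · filter_upwards [hσ, hτ] with ω h1 h2 n
      have ho := phiLoynes_ordered (θ := θ) (σ := σ) (τ := τ) hpS n ω
      have h3 := phiLevel_le hpS (s := σ ω) ho k
      have h4 : phiLoynes θ σ τ hpS n ω ⟨p, hpS⟩ ≤ phiLoynes θ σ τ hpS n ω ⟨k, hk⟩ :=
        ho.1 (Fin.le_def.2 hpk)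
      have h5 := ho.2 ⟨k, hk⟩
      have h6 : max (phiLevel hpS (σ ω) (phiLoynes θ σ τ hpS n ω) k
          - phiLoynes θ σ τ hpS n ω ⟨k, hk⟩) 0 ≤ σ ω := max_le (by linarith) h1
      have h7 := le_max_right (phiLevel hpS (σ ω) (phiLoynes θ σ τ hpS n ω) k
          - phiLoynes θ σ τ hpS n ω ⟨k, hk⟩) 0
      have h8 : 0 ≤ ((S : ℝ) - k) * min (τ ω) (phiLoynes θ σ τ hpS n ω ⟨k, hk⟩) :=
        mul_nonneg (by linarith) (le_min h2.le h5)
      have h9 : ((S : ℝ) - k) * min (τ ω) (phiLoynes θ σ τ hpS n ω ⟨k, hk⟩) ≤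
          ((S : ℝ) - k) * τ ω := mul_le_mul_of_nonneg_left (min_le_left _ _) (by linarith)
      rw [abs_le]
      constructor <;> linarith
    · filter_upwards [hg, hunb] with ω h1 h2
      refine h1.sub (Tendsto.const_mul _ (tendsto_const_nhds.congr' ?_))
      filter_upwards [(tendsto_phiLoynes_atTop h2).eventually_ge_atTop (τ ω)] with n hn
      exact (min_eq_left hn).symm
  -- If `k = p`, the inserted excess tends to `σ 1{Y(1) > 0}`. If `k > p`, the level is at most `σ +
  -- c`, with `c` a bound for coordinate `p`, and the excess over the exploding coordinate `k`
  -- eventually vanishes.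
  rcases hpk.eq_or_lt with rfl | hpk'
  · obtain ⟨Y, hYs, hYlim⟩ := exists_psi_solution hθ' hσm hτm hpS hbdd hunb
    have hYm : MeasurableSet {ω' | 0 < Y ω' ⟨0, hp⟩} :=
      measurableSet_lt measurable_const ((measurable_pi_apply _).comp hYs.measurable)
    have := hdrift ({ω' | 0 < Y ω' ⟨0, hp⟩}.indicator σ) ?_
    · rw [integral_sub (hσi.indicator hYm) (hτi.const_mul _), integral_const_mul] at this
      linarith [hY Y hYs]
    · filter_upwards [hYlim, hunb, hσ] with ω h1 h2 h3
      have h0 := h1 ⟨0, hp⟩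
      -- When the limit is not positive, this keeps the indicator off for all `n`, not merely in the
      -- limit.
      have hle : ∀ n, phiLoynes θ σ τ hpS n ω ⟨0, Nat.zero_lt_of_lt hpS⟩ ≤ Y ω ⟨0, hp⟩ :=
        fun n => Monotone.ge_of_tendsto (fun m n h => phiLoynes_mono hpS ω h _) h0 n
      refine tendsto_const_nhds.congr' ?_
      by_cases hY0 : 0 < Y ω ⟨0, hp⟩
      · rw [Set.indicator_of_mem (by exact hY0)]
        filter_upwards [h0.eventually_const_lt hY0] with n hn
        have hn' : 0 < phiLoynes θ σ τ hpS n ω ⟨0, Nat.zero_lt_of_lt hpS⟩ := hn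
        rw [phiLevel, if_neg (lt_irrefl _), if_pos hn', add_sub_cancel_right, max_eq_left h3]
      · rw [Set.indicator_of_notMem (by exact hY0)]
        filter_upwards [(tendsto_phiLoynes_atTop h2).eventually_ge_atTop (σ ω)] with n hn
        rw [phiLevel, if_neg (lt_irrefl _), if_neg fun h => hY0 (h.trans_le (hle n)), add_zero,
          max_eq_right (by linarith)]
  · have := hdrift (fun _ => 0) ?_
    · simp only [zero_sub] at this
      rw [integral_neg, integral_const_mul] at this
      have := mul_pos (sub_pos.2 hkS) hpos
      linarith
    · filter_upwards [hbdd, hunb] with ω h1 h2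
      obtain ⟨c, hc⟩ := h1 ⟨p, hpS⟩ hpk'
      refine tendsto_const_nhds.congr' ?_
      filter_upwards [(tendsto_phiLoynes_atTop h2).eventually_ge_atTop (σ ω + c)] with n hn
      have h3 := phiLevel_le hpS (s := σ ω)
        (phiLoynes_ordered (θ := θ) (σ := σ) (τ := τ) hpS n ω) k
      have h4 := hc ⟨n, rfl⟩
      simp only at h4
      rw [max_eq_right (by linarith)]

end Stability

/-! ### Ascending rearrangements -/

section Ascending

variable {q : ℕ} {u w : Fin q → ℝ}

theorem monotone_ascending (u : Fin q → ℝ) : Monotone (ascending u) := Tuple.monotone_sort u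

theorem ascending_of_monotone (hu : Monotone u) : ascending u = u := by
  rw [ascending, Tuple.sort_eq_refl_iff_monotone.2 hu]
  rfl

theorem ascending_comp_perm (u : Fin q → ℝ) (e : Equiv.Perm (Fin q)) :
    ascending (u ∘ e) = ascending u := Tuple.comp_perm_comp_sort_eq_comp_sort

/-- Counting the entries below `c` avoids the sorting permutation, which depends on `u`; both
domination and measurability are read off from this count. -/
theorem ascending_le_iff {j : Fin q} {c : ℝ} :
    ascending u j ≤ c ↔ j.val < (Finset.univ.filter fun i => u i ≤ c).card := by
  rw [← Tuple.lt_card_le_iff_apply_le_of_monotone (monotone_ascending u)]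
  have : (Finset.univ.filter fun i => ascending u i ≤ c).card =
      (Finset.univ.filter fun i => u i ≤ c).card :=
    Finset.card_equiv (Tuple.sort u) fun i => by
      rw [Finset.mem_filter, Finset.mem_filter]; simp [ascending]
  rw [this]

theorem ascending_le {j : Fin q} {c : ℝ} (s : Finset (Fin q)) (hs : j.val < s.card)
    (h : ∀ i ∈ s, u i ≤ c) : ascending u j ≤ c :=
  ascending_le_iff.2 (hs.trans_le (Finset.card_le_card fun i hi => by simp [h i hi]))

theorem measurable_ascending : Measurable (ascending : (Fin q → ℝ) → Fin q → ℝ) := by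
  refine measurable_pi_iff.2 fun j => measurable_of_Iic fun c => ?_
  have : (fun u : Fin q → ℝ => ascending u j) ⁻¹' Set.Iic c =
      {u | j.val < ∑ i : Fin q, if u i ≤ c then 1 else 0} := by
    ext u
    simp [ascending_le_iff]
  rw [this]
  refine measurableSet_lt measurable_const (Finset.measurable_fun_sum _ fun i _ => ?_)
  exact Measurable.ite (measurableSet_le (measurable_pi_apply i) measurable_const)
    measurable_const measurable_const

end Ascending

/-! ### The map `G^p` -/

/-- Workloads, not reordered, before the next arrival, when server `i` receives a service time `s`
and a time `t` elapses. -/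
noncomputable def serve {q : ℕ} (i : Fin q) (s t : ℝ) (w : Fin q → ℝ) : Fin q → ℝ :=
  fun j => max (w j + (if j = i then s else 0) - t) 0

section GMap

variable {S p : ℕ} (hpS : p < S) {s t : ℝ} {u v : Fin S → ℝ}

theorem routeTo_eq_ascending_serve {q : ℕ} (k : Fin q) (s t : ℝ) (u : Fin q → ℝ) :
    routeTo k s t u = ascending (serve k s t u) := rfl

theorem routeTo_ordered {q : ℕ} (k : Fin q) (s t : ℝ) (u : Fin q → ℝ) :
    IsOrderedProfile (routeTo k s t u) :=
  ⟨monotone_ascending _, fun _ => le_max_right _ _⟩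

theorem GMap_ordered : IsOrderedProfile (GMap hpS s t u) := by
  unfold GMap
  split_ifs <;> exact routeTo_ordered _ _ _ _

theorem measurable_GMap {Ω : Type*} [MeasurableSpace Ω] {f g : Ω → ℝ} {X : Ω → Fin S → ℝ}
    (hf : Measurable f) (hg : Measurable g) (hX : Measurable X) :
    Measurable fun ω => GMap hpS (f ω) (g ω) (X ω) := by
  have hXi : ∀ i, Measurable fun ω => X ω i := fun i => (measurable_pi_apply i).comp hX
  have hroute : ∀ k, Measurable fun ω => routeTo k (f ω) (g ω) (X ω) := by
    intro k
    refine measurable_ascending.comp (measurable_pi_iff.2 fun i => ?_)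
    by_cases hi : i = k
    · simp only [hi, if_true]
      exact (((hXi k).add hf).sub hg).max measurable_const
    · simp only [hi, if_false]
      exact (((hXi i).add measurable_const).sub hg).max measurable_const
  exact Measurable.ite (measurableSet_eq_fun (hXi _) measurable_const) (hroute _) (hroute _)

/-- Sending a customer to the server of rank `k` is dominated by the map `Φ^p` if its workload does
not exceed the levels of `Φ^p` from rank `k` on. -/
theorem routeTo_le_PhiMap (hu : Monotone u) {k : Fin S}
    (hk : ∀ j, k ≤ j → u k + s ≤ phiLevel hpS s u j.val) :
    routeTo k s t u ≤ PhiMap hpS s t u := by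
  intro j
  have h1 : ascending (serve k s t u) j ≤ max (max (u j) (phiLevel hpS s u j) - t) 0 := by
    -- Two bounds on rank `j`, each from `j + 1` entries: here the first `j + 1` servers, and below
    -- the first `j + 2` with the served one removed.
    refine ascending_le (Finset.Iic j) (by simp) fun i hi => ?_
    rw [Finset.mem_Iic] at hi
    unfold serve
    gcongr
    by_cases hik : i = k
    · subst hik
      simpa using Or.inr (hk j hi)
    · simpa [hik] using Or.inl (hu hi)
  by_cases h : j.val + 1 < S
  · have h2 : ascending (serve k s t u) j ≤ max (u ⟨j.val + 1, h⟩ - t) 0 := by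
      refine ascending_le ((Finset.Iic ⟨j.val + 1, h⟩).erase k) ?_ fun i hi => ?_
      · have := Finset.pred_card_le_card_erase (a := k) (s := Finset.Iic (⟨j.val + 1, h⟩ : Fin S))
        simp at this
        omega
      · rw [Finset.mem_erase, Finset.mem_Iic] at hi
        unfold serve
        rw [if_neg hi.1, add_zero]
        have := hu hi.2
        gcongr
    rw [PhiMap_of_lt hpS h, ← min_sub_sub_right, max_min_distrib_right]
    exact le_min h1 h2
  · rw [PhiMap_of_not_lt hpS h]
    exact h1

/-- The levels of `PhiMap` are chosen for this: `s` is the new workload of a free server, and `s + u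
p` is that of the server of rank `p` when all are busy. -/
theorem GMap_le_PhiMap (hu : IsOrderedProfile u) : GMap hpS s t u ≤ PhiMap hpS s t u := by
  unfold GMap
  split_ifs with h0
  · refine routeTo_le_PhiMap hpS hu.1 fun j _ => ?_
    simp [phiLevel, h0]
  · refine routeTo_le_PhiMap hpS hu.1 fun j hj => ?_
    have hpos : 0 < u ⟨0, Nat.zero_lt_of_lt hpS⟩ := lt_of_le_of_ne (hu.2 _) (Ne.symm h0)
    have hj' : ¬ j.val < p := not_lt.2 (Fin.le_def.1 hj)
    simp [phiLevel, hpos, hj', add_comm]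

/-- If some server is free, the service profile evolves as if the customer joined any free
server. -/
theorem GMap_ascending {w : Fin S → ℝ} (hw : ∀ i, 0 ≤ w i) {i : Fin S} (hi : w i = 0) :
    GMap hpS s t (ascending w) = ascending (serve i s t w) := by
  set z : Fin S := ⟨0, Nat.zero_lt_of_lt hpS⟩ with hz
  have h0 : ascending w z = 0 := by
    refine le_antisymm (ascending_le {i} (by simp [hz]) (by simp [hi])) (hw _)
  rw [GMap, if_pos h0, routeTo_eq_ascending_serve]
  have hsort : w (Tuple.sort w z) = 0 := h0
  -- Server `i` and the server sorted first are both empty, so exchanging them leaves `w` unchanged.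
  have hswap : w ∘ (Equiv.swap i (Tuple.sort w z)) = w := by
    funext j
    simp only [Function.comp_apply, Equiv.swap_apply_def]
    split_ifs with h1 h2
    · rw [h1, hi, hsort]
    · rw [h2, hi, hsort]
    · rfl
  have : serve z s t (ascending w) =
      serve i s t w ∘ ((Tuple.sort w).trans (Equiv.swap i (Tuple.sort w z))) := by
    funext j
    have h1 : w (Equiv.swap i (Tuple.sort w z) (Tuple.sort w j)) = w (Tuple.sort w j) :=
      congrFun hswap _
    have h2 : Equiv.swap i (Tuple.sort w z) (Tuple.sort w j) = i ↔ j = z := by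
      rw [Equiv.swap_apply_eq_iff, Equiv.swap_apply_left, (Tuple.sort w).injective.eq_iff]
    simp [serve, ascending, h1, h2]
  rw [this, ascending_comp_perm]

end GMap

/-! ### Renovating events and the solution of the equation driven by `G^p` -/

/-- The first `n` steps of the recursion driven by `F`, started from `u` at time `0`. -/
def trajectory {Ω : Type*} [MeasurableSpace Ω] (θ : Ω ≃ᵐ Ω) {q : ℕ}
    (F : Ω → (Fin q → ℝ) → (Fin q → ℝ)) (ω : Ω) (u : Fin q → ℝ) : ℕ → Fin q → ℝ
  | 0 => u
  | n + 1 => F (θ^[n] ω) (trajectory θ F ω u n)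

section Renovation

variable {Ω : Type*} [MeasurableSpace Ω] {P : Measure Ω} {θ : Ω ≃ᵐ Ω} {q : ℕ}
  {F : Ω → (Fin q → ℝ) → (Fin q → ℝ)}

theorem iterate_iterate_symm (n : ℕ) (ω : Ω) : θ^[n] (θ.symm^[n] ω) = ω :=
  (show Function.LeftInverse θ θ.symm from θ.apply_symm_apply).iterate n ω

theorem loynes_add (m n : ℕ) (ω : Ω) :
    loynes θ F (m + n) ω =
      trajectory θ F (θ.symm^[n] ω) (loynes θ F m (θ.symm^[n] ω)) n := by
  induction n generalizing ω with
  | zero => rfl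
  | succ n ih =>
    have h := ih (θ.symm ω)
    rw [← Function.iterate_succ_apply] at h
    rw [← add_assoc, loynes, h, trajectory]
    congr 1
    rw [Function.iterate_succ_apply, iterate_iterate_symm]

theorem trajectory_eq_of_le {ω : Ω} {u v : Fin q → ℝ} {m n : ℕ} (hmn : m ≤ n)
    (h : trajectory θ F ω u m = trajectory θ F ω v m) :
    trajectory θ F ω u n = trajectory θ F ω v n := by
  induction n, hmn using Nat.le_induction with
  | base => exact h
  | succ n _ ih => rw [trajectory, trajectory, ih]

/-- If the Loynes scheme is almost surely eventually constant, its limit is a solution. -/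
theorem exists_isSolution_of_eventually_const (hθ : MeasurePreserving θ P P)
    (hF : ∀ ω u, IsOrderedProfile u → IsOrderedProfile (F ω u))
    (hmeas : ∀ X, Measurable X → Measurable fun ω => F ω (X ω))
    (hconst : ∀ᵐ ω ∂P, ∃ n, ∀ m, n ≤ m → loynes θ F m ω = loynes θ F n ω) :
    ∃ W, IsSolution P θ F W := by
  classical
  have hm := fun n => measurable_loynes (θ := θ) hmeas n
  let C : ℕ → Ω → Prop := fun n ω => ∀ m, n ≤ m → loynes θ F m ω = loynes θ F n ω
  have hC : ∀ n, MeasurableSet {ω | C n ω} := by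
    intro n
    have : {ω | C n ω} = ⋂ m, ⋂ (_ : n ≤ m), {ω | loynes θ F m ω = loynes θ F n ω} := by
      ext; simp [C]
    rw [this]
    exact .iInter fun m => .iInter fun _ => measurableSet_eq_fun (hm m) (hm n)
  have hE : MeasurableSet {ω | ∃ n, C n ω} := by
    have : {ω | ∃ n, C n ω} = ⋃ n, {ω | C n ω} := by ext; simp
    rw [this]
    exact .iUnion hC
  -- Weakening `C` to an implication makes the search for `n` total; off the good event it returns
  -- 0.
  let Q : ℕ → Ω → Prop := fun n ω => (∃ k, C k ω) → C n ω
  have hQ : ∀ ω, ∃ n, Q n ω := by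
    intro ω
    by_cases h : ∃ k, C k ω
    · obtain ⟨k, hk⟩ := h
      exact ⟨k, fun _ => hk⟩
    · exact ⟨0, fun h' => absurd h' h⟩
  refine ⟨fun ω => loynes θ F (Nat.find (hQ ω)) ω, Measurable.find hm (fun n => ?_) hQ,
    fun ω => loynes_ordered hF _ _, ?_⟩
  · have : {ω | Q n ω} = {ω | ∃ k, C k ω}ᶜ ∪ {ω | C n ω} := by
      ext ω
      simp only [Q, Set.mem_union, Set.mem_compl_iff]
      exact imp_iff_not_or
    rw [this]
    exact hE.compl.union (hC n)
  · filter_upwards [hconst, hθ.quasiMeasurePreserving.ae hconst] with ω h1 h2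
    have h3 := Nat.find_spec (hQ ω) h1
    have h4 := Nat.find_spec (hQ (θ ω)) h2
    rw [← h4 (max (Nat.find (hQ ω)) (Nat.find (hQ (θ ω))) + 1) (by omega), loynes_succ_apply,
      h3 _ (le_max_left _ _)]

/-- The event contains its preimage under the ergodic map `θ⁻¹`, and by stationarity its probability
is at least `P A > 0`. -/
theorem ae_exists_iterate_symm_mem [IsFiniteMeasure P] (hθ : Ergodic θ P) {A : Set Ω}
    (hA : MeasurableSet A) (hpos : 0 < P A) (N : ℕ) :
    ∀ᵐ ω ∂P, ∃ n, N ≤ n ∧ θ.symm^[n] ω ∈ A := by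
  set B : Set Ω := {ω | ∃ n, N ≤ n ∧ θ.symm^[n] ω ∈ A} with hBdef
  have hAn : ∀ n, MeasurableSet (θ.symm^[n] ⁻¹' A) := fun n =>
    θ.symm.measurable.iterate n hA
  have hB : MeasurableSet B := by
    have : B = ⋃ n, ⋃ (_ : N ≤ n), θ.symm^[n] ⁻¹' A := by ext; simp [B]
    rw [this]
    exact .iUnion fun n => .iUnion fun _ => hAn n
  have hsub : θ.symm ⁻¹' B ⊆ B := by
    rintro ω ⟨n, hn, h⟩
    exact ⟨n + 1, by omega, by rwa [Function.iterate_succ_apply]⟩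
  rcases hθ.symm.ae_empty_or_univ_of_preimage_ae_le hB.nullMeasurableSet hsub.eventuallyLE
    with h | h
  · have h1 : P (θ.symm^[N] ⁻¹' A) ≤ P B := measure_mono fun ω hω => ⟨N, le_rfl, hω⟩
    rw [(hθ.symm.toMeasurePreserving.iterate N).measure_preimage hA.nullMeasurableSet,
      ae_eq_empty.1 h] at h1
    exact absurd hpos (not_lt.2 h1)
  · exact eventuallyEq_univ.1 h

end Renovation

/-! ### Merging of all profiles below `V` over `S` arrivals -/

section Coupling

variable {Ω : Type*} [MeasurableSpace Ω] {P : Measure Ω} {θ : Ω ≃ᵐ Ω} {σ τ : Ω → ℝ} {S p : ℕ}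

/-- If each of the `S` initial workloads is completed before the arrival of the corresponding
customer, the service profile after `S` arrivals does not depend on the initial one. -/
theorem trajectory_GMap_eq (hpS : p < S) {ω : Ω}
    (hτ : ∀ k, 0 ≤ τ (θ^[k] ω)) {v : Fin S → ℝ}
    (hv : ∀ i : Fin S, v i ≤ ∑ k ∈ Finset.range i.val, τ (θ^[k] ω)) {u u' : Fin S → ℝ}
    (hu : IsOrderedProfile u) (hu' : IsOrderedProfile u') (huv : u ≤ v) (huv' : u' ≤ v) :
    trajectory θ (fun ω => GMap hpS (σ ω) (τ ω)) ω u S =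
      trajectory θ (fun ω => GMap hpS (σ ω) (τ ω)) ω u' S := by
  -- Servers keep their labels and customer `n` is sent to server `n`. Served servers agree in both
  -- systems; the others have only been draining and lie below the drained `v`. By `hv` server `n`
  -- is thus empty in both when its customer arrives, and `GMap_ascending` allows that choice.
  suffices h : ∀ n, n ≤ S → ∃ w w' : Fin S → ℝ,
      trajectory θ (fun ω => GMap hpS (σ ω) (τ ω)) ω u n = ascending w ∧
      trajectory θ (fun ω => GMap hpS (σ ω) (τ ω)) ω u' n = ascending w' ∧
      (∀ i, 0 ≤ w i) ∧ (∀ i, 0 ≤ w' i) ∧ (∀ i, i.val < n → w i = w' i) ∧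
      ∀ i, n ≤ i.val → w i ≤ max (v i - ∑ k ∈ Finset.range n, τ (θ^[k] ω)) 0 ∧
        w' i ≤ max (v i - ∑ k ∈ Finset.range n, τ (θ^[k] ω)) 0 by
    obtain ⟨w, w', h1, h2, -, -, h3, -⟩ := h S le_rfl
    rw [h1, h2, funext fun i => h3 i i.isLt]
  intro n
  induction n with
  | zero =>
    intro _
    refine ⟨u, u', (ascending_of_monotone hu.1).symm, (ascending_of_monotone hu'.1).symm, hu.2,
      hu'.2, fun i hi => absurd hi (Nat.not_lt_zero _), fun i _ => ?_⟩
    simp [huv i, huv' i]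
  | succ n ih =>
    intro hn
    obtain ⟨w, w', h1, h2, hw, hw', heq, hle⟩ := ih (by omega)
    have hmax : max (v ⟨n, hn⟩ - ∑ k ∈ Finset.range n, τ (θ^[k] ω)) 0 = 0 :=
      max_eq_right (by linarith [hv ⟨n, hn⟩])
    have h0 := hle ⟨n, hn⟩ le_rfl
    rw [hmax] at h0
    have hw0 : w ⟨n, hn⟩ = 0 := le_antisymm h0.1 (hw _)
    have hw0' : w' ⟨n, hn⟩ = 0 := le_antisymm h0.2 (hw' _)
    refine ⟨serve ⟨n, hn⟩ (σ (θ^[n] ω)) (τ (θ^[n] ω)) w,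
      serve ⟨n, hn⟩ (σ (θ^[n] ω)) (τ (θ^[n] ω)) w', ?_, ?_, fun _ => le_max_right _ _,
      fun _ => le_max_right _ _, fun i hi => ?_, fun i hi => ?_⟩
    · rw [trajectory, h1, GMap_ascending hpS hw hw0]
    · rw [trajectory, h2, GMap_ascending hpS hw' hw0']
    · have : w i = w' i := by
        rcases Nat.lt_succ_iff_lt_or_eq.1 hi with h | h
        · exact heq i h
        · rw [show i = ⟨n, hn⟩ from Fin.ext h, hw0, hw0']
      simp only [serve, this]
    · have hne : i ≠ ⟨n, hn⟩ := fun h => by rw [h] at hi; simp at hi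
      have hb : ∀ a : ℝ, a ≤ max (v i - ∑ k ∈ Finset.range n, τ (θ^[k] ω)) 0 →
          max (a + 0 - τ (θ^[n] ω)) 0 ≤
            max (v i - ∑ k ∈ Finset.range (n + 1), τ (θ^[k] ω)) 0 := by
        intro a ha
        rw [Finset.sum_range_succ]
        refine max_le ?_ (le_max_right _ _)
        rcases le_max_iff.1 ha with h | h
        · exact le_max_of_le_left (by linarith)
        · exact le_max_of_le_right (by linarith [hτ n])
      have h := hle i (by omega)
      simp only [serve, if_neg hne]
      exact ⟨hb _ h.1, hb _ h.2⟩

/-- If `V` solves the equation driven by `Φ^p` and all its workloads are completed, with positive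
probability, before the arrivals of the corresponding customers, then the equation driven by `G^p`
has a solution. -/
theorem exists_isSolution_GMap [IsFiniteMeasure P] (hθ : Ergodic θ P) (hσm : Measurable σ)
    (hτm : Measurable τ) (hτ : ∀ᵐ ω ∂P, 0 < τ ω) (hpS : p < S)
    {V : Ω → Fin S → ℝ} (hV : IsSolution P θ (fun ω => PhiMap hpS (σ ω) (τ ω)) V)
    (hpos : 0 < P {ω | ∀ i : Fin S, V ω i ≤ ∑ k ∈ Finset.range i.val, τ (θ^[k] ω)}) :
    ∃ W, IsSolution P θ (fun ω => GMap hpS (σ ω) (τ ω)) W := by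
  have hθ' := hθ.toMeasurePreserving
  have hA : MeasurableSet {ω | ∀ i : Fin S, V ω i ≤ ∑ k ∈ Finset.range i.val, τ (θ^[k] ω)} := by
    have : {ω | ∀ i : Fin S, V ω i ≤ ∑ k ∈ Finset.range i.val, τ (θ^[k] ω)} =
        ⋂ i : Fin S, {ω | V ω i ≤ ∑ k ∈ Finset.range i.val, τ (θ^[k] ω)} := by
      ext; simp
    rw [this]
    exact .iInter fun i => measurableSet_le ((measurable_pi_apply i).comp hV.measurable)
      (Finset.measurable_fun_sum _ fun k _ => hτm.comp (θ.measurable.iterate k))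
  have hord : ∀ ω u, IsOrderedProfile u → IsOrderedProfile (GMap hpS (σ ω) (τ ω) u) :=
    fun _ _ _ => GMap_ordered hpS
  refine exists_isSolution_of_eventually_const hθ' hord
    (fun _ hX => measurable_GMap hpS hσm hτm hX) ?_
  have hle := ae_loynes_le (P := P) (θ := θ) hθ' hord (ae_of_all _ fun ω u v hu _ huv =>
    (GMap_le_PhiMap hpS hu).trans (PhiMap_mono hpS hu.2 huv)) hV
  have hτ' : ∀ᵐ ω ∂P, ∀ k, 0 < τ (θ^[k] ω) :=
    ae_all_iff.2 fun k => (hθ'.iterate k).quasiMeasurePreserving.ae hτ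
  filter_upwards [ae_exists_iterate_symm_mem hθ hA hpos S,
    ae_forall_iterate_symm hθ' (hle.and hτ')] with ω ⟨n, hn, hnA⟩ hω
  obtain ⟨h1, h2⟩ := hω n
  refine ⟨n, fun m hm => ?_⟩
  obtain ⟨k, rfl⟩ := Nat.exists_eq_add_of_le' hm
  -- At time `-n` the scheme started `k` steps earlier and the one started there from 0 both lie
  -- below `V`, so they agree after `S ≤ n` steps and hence at time 0.
  have h3 := trajectory_GMap_eq (σ := σ) hpS (fun k => (h2 k).le) hnA
    (loynes_ordered hord k _) (loynes_ordered hord 0 _) (h1 k) (h1 0)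
  rw [loynes_add, trajectory_eq_of_le hn h3, ← loynes_add, Nat.zero_add]

end Coupling

end JSW

theorem mainTheorem3 {Ω : Type*} [MeasurableSpace Ω]
    (P : Measure Ω) [IsProbabilityMeasure P]
    (θ : Ω ≃ᵐ Ω) (hθ : Ergodic θ P)
    (σ τ : Ω → ℝ) (hσm : Measurable σ) (hτm : Measurable τ)
    (hσi : Integrable σ P) (hτi : Integrable τ P)
    (hσ : ∀ᵐ ω ∂P, 0 ≤ σ ω) (hτ : ∀ᵐ ω ∂P, 0 < τ ω)
    (S p : ℕ) (hp : 0 < p) (hpS : p < S)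
    (hY : ∀ Y : Ω → Fin p → ℝ,
      JSW.IsSolution P θ (fun ω => JSW.PsiMap (σ ω) (τ ω)) Y →
        ∫ ω, {ω' | 0 < Y ω' ⟨0, hp⟩}.indicator σ ω ∂P < ((S : ℝ) - (p : ℝ)) * ∫ ω, τ ω ∂P) :
    (∃ V : Ω → Fin S → ℝ,
      JSW.IsMinimalSolution P θ (fun ω => JSW.PhiMap hpS (σ ω) (τ ω)) V) ∧
    ∀ V : Ω → Fin S → ℝ,
      JSW.IsMinimalSolution P θ (fun ω => JSW.PhiMap hpS (σ ω) (τ ω)) V →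
      0 < P {ω | V ω ⟨0, Nat.zero_lt_of_lt hpS⟩ = 0 ∧
        ∀ ℓ : ℕ, 2 ≤ ℓ → ∀ hℓ : ℓ - 1 < S,
          V ω ⟨ℓ - 1, hℓ⟩ ≤ ∑ i ∈ Finset.range (ℓ - 1), τ (θ^[i] ω)} →
      ∃ W : Ω → Fin S → ℝ,
        JSW.IsSolution P θ (fun ω => JSW.GMap hpS (σ ω) (τ ω)) W := by
  refine ⟨⟨_, JSW.isMinimalSolution_loynesLimit hθ.toMeasurePreserving
    (fun _ _ => JSW.PhiMap_ordered hpS) (fun _ _ _ => JSW.PhiMap_mono hpS)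
    (fun _ hX => JSW.measurable_PhiMap hpS hσm hτm hX)
    (fun _ _ _ ha hlim => JSW.tendsto_PhiMap hpS ha hlim)
    (JSW.ae_bddAbove_phiLoynes hθ hσm hτm hσi hτi hσ hτ hp hpS hY)⟩, fun V hV hpos => ?_⟩
  -- Passing from ranks `ℓ` counted from 1 to indices `i = ℓ - 1`; the condition at `i = 0` has an
  -- empty sum and is the one that the first workload vanishes.
  refine JSW.exists_isSolution_GMap hθ hσm hτm hτ hpS hV.1
    (hpos.trans_le (measure_mono fun ω hω i => ?_))
  obtain ⟨i, hi⟩ := i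
  rcases Nat.eq_zero_or_pos i with rfl | h
  · simp [hω.1]
  · simpa using hω.2 (i + 1) (by omega) (by simpa using hi)
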